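/- Let $\mathcal P_2(\mathbb R^d)$ be the set of Borel probability measures on $\mathbb R^d$ with finite second moment, with the 2-Wasserstein distance $W_2$; let $\Gamma_o(\mu,\nu)$ be the set of optimal transport plans for the quadratic cost, and let $\mathrm{Tan}_\mu$ be the closure of $\{\nabla\varphi:\varphi\in C_c^\infty(\mathbb R^d)\}$ in $L^2(\mu)^d$. A vector field $\xi\in\mathrm{Tan}_\mu$ is the Wasserstein gradient at $\mu$ of $\Phi:\mathcal P_2(\mathbb R^d)\to\mathbb R$ if, as $W_2(\mu,\nu)\to0$, $$\Phi(\nu)-\Phi(\mu)=\int\langle \xi(x),y-x\rangle\,\gamma(\mathrm dx\,\mathrm dy)+O\big(W_2(\mu,\nu)^2\big)\qquad\text{for all }\gamma\in\Gamma_o(\mu,\nu).$$ Call $F:\mathcal P_2(\mathbb R^d)\to\mathbb R$ sufficiently smooth, with gradient $\nabla_\mu F:\mathcal P_2(\mathbb R^d)\times\mathbb R^d\to\mathbb R^d$ and Hessian kernel $\nabla_\mu^2F:\mathcal P_2(\mathbb R^d)\times\mathbb R^d\times\mathbb R^d\to\mathbb R^{d\times d}$, if for every $\mu\in\mathcal P_2(\mathbb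 R^d)$: 1. $\nabla_\mu F(\mu,\cdot)$ is the Wasserstein gradient of $F$ at $\mu$; 2. for every $x\in\mathbb R^d$ and $i\le d$, the $i$-th row of $\nabla_\mu^2F(\mu,x,\cdot)$ is the Wasserstein gradient at $\mu$ of $\nu\mapsto(\nabla_\mu F(\nu,x))_i$, where there are $r>0$ and a continuous $c\in L^2(\mu)$ such that the error is at most $c(x)\,W_2(\mu,\nu)^2$ for all $x$, $i$ and all $\nu$ with $W_2(\mu,\nu)<r$; 3. $\nabla_\mu F(\mu,\cdot)$ is of class $C^1$ on $\mathbb R^d$, and its derivative $\nabla\nabla_\mu F(\mu,\cdot)$ is $\mu$-essentially bounded; 4. $\nabla_\mu^2F(\mu,\cdot,\cdot)\in L^2(\mu\otimes\mu)$. Let $F$ be sufficiently smooth, and let $\mu^*\in\mathcal P_2(\mathbb R^d)$ be absolutely continuous with respect to Lebesgue measure and a $W_2$-local minimum of $F$, i.e. there is $r>0$ such that $F(\mu^*)\le F(\mu)$ whenever $W_2(\mu,\mu^*)<r$. Then $$H_{\mu^*}f(x)=\int\nabla_\mu^2F(\mu^*,x,y)\,f(y)\,\mu^*(\mathrm dy)$$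 defines a bounded linear operator on $L^2(\mu^*)^d$, and $H_{\mu^*}$ is positive semidefinite: $\langle v,H_{\mu^*}v\rangle_{L^2(\mu^*)}\ge0$ for all $v\in L^2(\mu^*)^d$. -/

import Mathlib

open MeasureTheory
open scoped ENNReal ContDiff RealInnerProductSpace

noncomputable section

namespace WassersteinOpt

/-- `ℝ^d` with its Euclidean norm. -/
abbrev Eu (d : ℕ) : Type := EuclideanSpace ℝ (Fin d)

/-- Borel probability measures on `ℝ^d` with finite second moment. -/
def P2 (d : ℕ) : Type :=
  {μ : Measure (Eu d) // IsProbabilityMeasure μ ∧ ∫⁻ x, ‖x‖ₑ ^ 2 ∂μ < ⊤}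

/-- The underlying measure. -/
abbrev P2.meas {d : ℕ} (μ : P2 d) : Measure (Eu d) := μ.1

instance P2.instIsProbabilityMeasure {d : ℕ} (μ : P2 d) : IsProbabilityMeasure μ.meas := μ.2.1

/-- Transport plans between `μ` and `ν`. -/
def couplings {d : ℕ} (μ ν : P2 d) : Set (Measure (Eu d × Eu d)) :=
  {γ | γ.map Prod.fst = μ.meas ∧ γ.map Prod.snd = ν.meas}

/-- Quadratic cost of a plan. -/
def cost {d : ℕ} (γ : Measure (Eu d × Eu d)) : ℝ≥0∞ := ∫⁻ p, ‖p.1 - p.2‖ₑ ^ 2 ∂γ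

/-- The 2-Wasserstein distance. -/
def W2 {d : ℕ} (μ ν : P2 d) : ℝ := Real.sqrt (⨅ γ ∈ couplings μ ν, cost γ).toReal

/-- Optimal transport plans. -/
def optimalPlans {d : ℕ} (μ ν : P2 d) : Set (Measure (Eu d × Eu d)) :=
  {γ | γ ∈ couplings μ ν ∧ ∀ γ' ∈ couplings μ ν, cost γ ≤ cost γ'}

/-- `ξ` lies in the tangent space at `μ`: the closure in `L²(μ; ℝ^d)` of the gradients of
smooth compactly supported functions. -/
def InTangent {d : ℕ} (μ : P2 d) (ξ : Eu d → Eu d) : Prop :=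
  MemLp ξ 2 μ.meas ∧ ∀ ε : ℝ≥0∞, 0 < ε → ∃ φ : Eu d → ℝ,
    ContDiff ℝ ∞ φ ∧ HasCompactSupport φ ∧ eLpNorm (fun x => ξ x - gradient φ x) 2 μ.meas < ε

/-- `ξ` is the (tangent) Wasserstein gradient at `μ` of the functional `Φ`, where the error is at
most `C * W₂(μ, ν)²` for all `ν` with `W₂(μ, ν) < r`. -/
def IsWGradientWith {d : ℕ} (Φ : P2 d → ℝ) (μ : P2 d) (ξ : Eu d → Eu d) (C r : ℝ) : Prop :=
  InTangent μ ξ ∧ ∀ ν : P2 d, W2 μ ν < r → ∀ γ ∈ optimalPlans μ ν,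
    |Φ ν - Φ μ - ∫ p, ⟪ξ p.1, p.2 - p.1⟫ ∂γ| ≤ C * W2 μ ν ^ 2

/-- `ξ` is the Wasserstein gradient of `Φ` at `μ`:
`Φ(ν) - Φ(μ) = ∫ ⟪ξ(x), y - x⟫ dγ + O(W₂(μ, ν)²)` for optimal plans `γ`, with `ξ` tangent. -/
def IsWGradient {d : ℕ} (Φ : P2 d → ℝ) (μ : P2 d) (ξ : Eu d → Eu d) : Prop :=
  ∃ C r : ℝ, 0 < r ∧ IsWGradientWith Φ μ ξ C r

/-- `F` is sufficiently smooth, with Wasserstein gradient `G μ x = ∇_μ F(μ, x)` and Wasserstein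
Hessian kernel `K μ x y = ∇_μ² F(μ, x, y)`. -/
structure SufficientlySmooth {d : ℕ} (F : P2 d → ℝ) (G : P2 d → Eu d → Eu d)
    (K : P2 d → Eu d → Eu d → Matrix (Fin d) (Fin d) ℝ) : Prop where
  /-- `G μ` is the Wasserstein gradient of `F` at `μ`; it is square integrable, being tangent. -/
  grad : ∀ μ, IsWGradient F μ (G μ)
  /-- For each `x`, the `i`-th component of `ν ↦ G ν x` has at `μ` the Wasserstein gradient
  `y ↦` (`i`-th row of `K μ x y`). The constant in the error `O(W₂²)` may depend on `x`, but is
  locally bounded and square integrable as a function of `x`. -/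
  hess : ∀ μ, ∃ (c : Eu d → ℝ) (r : ℝ), Continuous c ∧ MemLp c 2 μ.meas ∧ 0 < r ∧
    ∀ (x : Eu d) (i : Fin d),
      IsWGradientWith (fun ν => G ν x i) μ (fun y => WithLp.toLp 2 (K μ x y i)) (c x) r
  /-- `G μ` is continuously differentiable in the space variable. -/
  contDiff : ∀ μ, ContDiff ℝ 1 (G μ)
  /-- The kernel is square integrable for `μ ⊗ μ`. -/
  hess_memLp : ∀ μ i j, MemLp (fun p : Eu d × Eu d => K μ p.1 p.2 i j) 2 (μ.meas.prod μ.meas)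
  /-- The spatial derivative of `G μ` is `μ`-essentially bounded. -/
  deriv_bdd : ∀ μ, ∃ M : ℝ, ∀ᵐ x ∂μ.meas, ‖fderiv ℝ (G μ) x‖ ≤ M

/-- `μ` is a local minimum of `F` for the distance `W₂`. -/
def IsW2LocalMin {d : ℕ} (F : P2 d → ℝ) (μ : P2 d) : Prop :=
  ∃ r : ℝ, 0 < r ∧ ∀ ν : P2 d, W2 ν μ < r → F μ ≤ F ν

/-- `T` is the integral operator on `L²(μ; ℝ^d)` with matrix kernel `k`:
`(T f)(x) = ∫ k(x, y) f(y) μ(dy)`. -/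
def IsIntegralOperator {d : ℕ} (μ : P2 d) (k : Eu d → Eu d → Matrix (Fin d) (Fin d) ℝ)
    (T : Lp (Eu d) 2 μ.meas →L[ℝ] Lp (Eu d) 2 μ.meas) : Prop :=
  ∀ f : Lp (Eu d) 2 μ.meas,
    T f =ᵐ[μ.meas] fun x => ∫ y, Matrix.toEuclideanCLM (𝕜 := ℝ) (k x y) (f y) ∂μ.meas

end WassersteinOpt

end

/-! Fix a test function φ, put S_s = id + s∇φ and μ_s = (S_s)_# μ. For small s and h, moving μ_s to
μ_{s+h} along ∇φ is optimal (`displacePlan_mem_optimalPlans`), so W₂(μ_s, μ_{s+h})² = h²∫|∇φ|² dμ.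
The abstract expansions thus become derivatives along the curve: d/ds F(μ_s) = ∫⟨G(μ_s)(S_s x),
∇φ(x)⟩ dμ.

At a local minimum G(μ) = 0 μ-a.e. Since G(μ) is C¹ and μ is absolutely continuous, its spatial
derivative also vanishes μ-a.e. Hence s⁻¹ G(μ_s)∘S_s converges weakly in L²(μ) to H∇φ as s ↓ 0: the
term DG(μ)∇φ drops out and only the Hessian kernel survives (`tendsto_integral_inner_comp_shift`).
If ⟨H∇φ, ∇φ⟩ were negative, F(μ_s) would strictly decrease for small s > 0, contradicting
minimality.

It remains to pass from gradients to all of L². The rows of the kernel are tangent, so H kills the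
orthogonal complement of Tan. Since symmetry of H is not available, it is shown separately that H∇φ
is orthogonal to that complement: G(μ_s) is tangent at μ_s, which is tested against DS_s n for n
orthogonal to gradients, and then s ↓ 0. Continuity of H gives the rest. -/

noncomputable section

namespace WassersteinOpt

open Filter Topology

/-! ### Test functions and the maps id + s∇φ -/

section TestFunctions

variable {d : ℕ} {φ : Eu d → ℝ}

lemma contDiff_gradient (hφ : ContDiff ℝ ∞ φ) : ContDiff ℝ ∞ (gradient φ) := by
  have h : ContDiff ℝ ∞ (fderiv ℝ φ) := hφ.fderiv_right (by simp)
  exact (InnerProductSpace.toDual ℝ (Eu d)).symm.contDiff.comp h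

lemma hasCompactSupport_gradient (hc : HasCompactSupport φ) :
    HasCompactSupport (gradient φ) :=
  (hc.fderiv ℝ).comp_left (g := (InnerProductSpace.toDual ℝ (Eu d)).symm) (map_zero _)

lemma hasFDerivAt_toDual_gradient (hφ : ContDiff ℝ ∞ φ) (x : Eu d) :
    HasFDerivAt φ (InnerProductSpace.toDual ℝ (Eu d) (gradient φ x)) x := by
  rw [toDual_gradient]
  exact (hφ.differentiable (by simp)).differentiableAt.hasFDerivAt

lemma exists_bound_gradient (hφ : ContDiff ℝ ∞ φ) (hc : HasCompactSupport φ) :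
    ∃ A : ℝ, ∀ x, ‖gradient φ x‖ ≤ A :=
  (hasCompactSupport_gradient hc).exists_bound_of_continuous (contDiff_gradient hφ).continuous

lemma memLp_gradient (hφ : ContDiff ℝ ∞ φ) (hc : HasCompactSupport φ) {p : ℝ≥0∞}
    (μ : Measure (Eu d)) [IsFiniteMeasure μ] : MemLp (gradient φ) p μ := by
  obtain ⟨A, hA⟩ := exists_bound_gradient hφ hc
  exact MemLp.of_bound (contDiff_gradient hφ).continuous.aestronglyMeasurable A (ae_of_all _ hA)

lemma exists_lipschitz_gradient (hφ : ContDiff ℝ ∞ φ) (hc : HasCompactSupport φ) :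
    ∃ L : ℝ, 0 < L ∧ ∀ x y, ‖gradient φ x - gradient φ y‖ ≤ L * ‖x - y‖ := by
  obtain ⟨C, hC⟩ := (contDiff_gradient hφ).lipschitzWith_of_hasCompactSupport
    (hasCompactSupport_gradient hc) (by simp)
  refine ⟨C + 1, by positivity, fun x y => ?_⟩
  have := hC.dist_le_mul x y
  rw [dist_eq_norm, dist_eq_norm] at this
  nlinarith [norm_nonneg (x - y)]

/-- First order Taylor estimate for a function with Lipschitz gradient. -/
lemma abs_sub_sub_inner_gradient_le (hφ : ContDiff ℝ ∞ φ) {L : ℝ} (hL0 : 0 ≤ L)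
    (hL : ∀ x y, ‖gradient φ x - gradient φ y‖ ≤ L * ‖x - y‖) (x z : Eu d) :
    |φ x - φ z - ⟪gradient φ z, x - z⟫| ≤ L * ‖x - z‖ ^ 2 := by
  have h := Convex.norm_image_sub_le_of_norm_hasFDerivWithin_le' (f := φ)
    (f' := fun y => InnerProductSpace.toDual ℝ (Eu d) (gradient φ y))
    (φ := InnerProductSpace.toDual ℝ (Eu d) (gradient φ z)) (C := L * ‖x - z‖)
    (s := Metric.closedBall z ‖x - z‖) (x := z) (y := x)
    (fun y _ => (hasFDerivAt_toDual_gradient hφ y).hasFDerivWithinAt)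
    (fun y hy => by
      rw [← map_sub, LinearIsometryEquiv.norm_map]
      refine (hL y z).trans ?_
      rw [Metric.mem_closedBall, dist_eq_norm] at hy
      gcongr)
    (convex_closedBall _ _) (Metric.mem_closedBall_self (norm_nonneg _))
    (by simp [dist_eq_norm])
  rw [InnerProductSpace.toDual_apply_apply, Real.norm_eq_abs] at h
  linarith

/-- The displacement map `x ↦ x + s ∇φ(x)`. -/
def shift (φ : Eu d → ℝ) (s : ℝ) (x : Eu d) : Eu d := x + s • gradient φ x

lemma shift_zero (x : Eu d) : shift φ 0 x = x := by simp [shift]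

lemma contDiff_shift (hφ : ContDiff ℝ ∞ φ) (s : ℝ) : ContDiff ℝ ∞ (shift φ s) :=
  contDiff_id.add ((contDiff_gradient hφ).const_smul s)

lemma continuous_shift (hφ : ContDiff ℝ ∞ φ) (s : ℝ) : Continuous (shift φ s) :=
  (contDiff_shift hφ s).continuous

lemma norm_shift_sub_ge {L : ℝ} (hL : ∀ x y, ‖gradient φ x - gradient φ y‖ ≤ L * ‖x - y‖)
    {s : ℝ} (hs : |s| * L ≤ 1 / 2) (x z : Eu d) :
    ‖x - z‖ ≤ 2 * ‖shift φ s x - shift φ s z‖ := by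
  have h1 : x - z = (shift φ s x - shift φ s z) - s • (gradient φ x - gradient φ z) := by
    simp only [shift]; module
  have h2 : ‖x - z‖ ≤ ‖shift φ s x - shift φ s z‖ + |s| * ‖gradient φ x - gradient φ z‖ := by
    conv_lhs => rw [h1]
    refine (norm_sub_le _ _).trans ?_
    rw [norm_smul, Real.norm_eq_abs]
  have h3 : |s| * ‖gradient φ x - gradient φ z‖ ≤ 1 / 2 * ‖x - z‖ := by
    calc _ ≤ |s| * (L * ‖x - z‖) := by gcongr; exact hL x z
      _ = |s| * L * ‖x - z‖ := by ring
      _ ≤ _ := by gcongr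
  linarith

/-- `shift φ s` contracts distances by at most a factor 2, hence is injective; a continuous
injection between Polish spaces is a measurable embedding. -/
lemma measurableEmbedding_shift (hφ : ContDiff ℝ ∞ φ) {L : ℝ}
    (hL : ∀ x y, ‖gradient φ x - gradient φ y‖ ≤ L * ‖x - y‖)
    {s : ℝ} (hs : |s| * L ≤ 1 / 2) : MeasurableEmbedding (shift φ s) := by
  refine (continuous_shift hφ s).measurableEmbedding fun x z hxz => ?_
  have := norm_shift_sub_ge hL hs x z
  rw [hxz, sub_self, norm_zero, mul_zero] at this
  exact sub_eq_zero.1 (norm_le_zero_iff.1 this)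

/-- The potential generating the displacement `∇φ` as seen from the points `shift φ s x`. -/
def movedPotential (φ : Eu d → ℝ) (s : ℝ) (x : Eu d) : ℝ := φ x + s / 2 * ‖gradient φ x‖ ^ 2

lemma movedPotential_bound (hφ : ContDiff ℝ ∞ φ) (hc : HasCompactSupport φ) (s : ℝ) :
    Continuous (movedPotential φ s) ∧ ∃ A : ℝ, ∀ x, ‖movedPotential φ s x‖ ≤ A := by
  obtain ⟨A, hA⟩ := exists_bound_gradient hφ hc
  obtain ⟨B, hB⟩ := hc.exists_bound_of_continuous hφ.continuous
  have hg := (contDiff_gradient hφ).continuous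
  refine ⟨hφ.continuous.add (continuous_const.mul (hg.norm.pow 2)), B + |s / 2| * A ^ 2,
    fun x => ?_⟩
  refine (norm_add_le _ _).trans (add_le_add (hB x) ?_)
  rw [norm_mul, Real.norm_eq_abs, norm_pow, norm_norm]
  gcongr
  exact hA x

/-- This is a dual certificate of optimality: the potential differences integrate to zero against
every plan, leaving the cost of the displacement as a lower bound. Expanding the square leaves |X|²
plus 2h times the Taylor remainder of the potential, which is at most 8L|X|²; this explains the 16
in `hh`. -/
lemma sq_norm_le_shift_sub_shift (hφ : ContDiff ℝ ∞ φ) {L : ℝ} (hL0 : 0 < L)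
    (hL : ∀ x y, ‖gradient φ x - gradient φ y‖ ≤ L * ‖x - y‖)
    {s h : ℝ} (hs : |s| * L ≤ 1 / 2) (hh : 16 * |h| * L ≤ 1) (x z : Eu d) :
    h ^ 2 * ‖gradient φ z‖ ^ 2 ≤ ‖shift φ s x - shift φ (s + h) z‖ ^ 2
      + 2 * h * (movedPotential φ s x - movedPotential φ s z) := by
  set X := shift φ s x - shift φ s z with hX
  have e1 : shift φ s x - shift φ (s + h) z = X - h • gradient φ z := by
    simp only [shift, hX]; module
  -- The term s/2 |∇φ|² in the potential makes the corrections of order s combine into a single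
  -- square.
  have e2 : movedPotential φ s x - movedPotential φ s z - ⟪gradient φ z, X⟫
      = (φ x - φ z - ⟪gradient φ z, x - z⟫) + s / 2 * ‖gradient φ x - gradient φ z‖ ^ 2 := by
    have : X = (x - z) + s • (gradient φ x - gradient φ z) := by
      simp only [shift, hX]; module
    rw [this, @norm_sub_sq_real, inner_add_right, inner_smul_right, inner_sub_right,
      inner_sub_right, real_inner_self_eq_norm_sq, real_inner_comm (gradient φ x)]
    simp only [movedPotential]
    ring
  have b1 := abs_sub_sub_inner_gradient_le hφ hL0.le hL x z
  have b2 : |s / 2 * ‖gradient φ x - gradient φ z‖ ^ 2| ≤ L * ‖x - z‖ ^ 2 := by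
    rw [abs_mul, abs_div, abs_two, abs_of_nonneg (sq_nonneg ‖gradient φ x - gradient φ z‖)]
    calc |s| / 2 * ‖gradient φ x - gradient φ z‖ ^ 2
        ≤ |s| / 2 * (L * ‖x - z‖) ^ 2 := by gcongr; exact hL x z
      _ = (|s| * L) * (L * ‖x - z‖ ^ 2 / 2) := by ring
      _ ≤ 1 / 2 * (L * ‖x - z‖ ^ 2 / 2) := by gcongr
      _ ≤ _ := by nlinarith [mul_nonneg hL0.le (sq_nonneg ‖x - z‖)]
  have b3 := norm_shift_sub_ge hL hs x z
  rw [← hX] at b3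
  have b4 : |movedPotential φ s x - movedPotential φ s z - ⟪gradient φ z, X⟫|
      ≤ 8 * L * ‖X‖ ^ 2 := by
    rw [e2]
    refine (abs_add_le _ _).trans ?_
    have : ‖x - z‖ ^ 2 ≤ (2 * ‖X‖) ^ 2 := by gcongr
    nlinarith
  have b5 : |2 * h * (movedPotential φ s x - movedPotential φ s z - ⟪gradient φ z, X⟫)|
      ≤ ‖X‖ ^ 2 := by
    rw [abs_mul, abs_mul, abs_two]
    calc 2 * |h| * _ ≤ 2 * |h| * (8 * L * ‖X‖ ^ 2) := by gcongr
      _ = (16 * |h| * L) * ‖X‖ ^ 2 := by ring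
      _ ≤ 1 * ‖X‖ ^ 2 := by gcongr
      _ = _ := one_mul _
  rw [e1, @norm_sub_sq_real, inner_smul_right, norm_smul, mul_pow, Real.norm_eq_abs, sq_abs,
    real_inner_comm]
  have := neg_le_of_abs_le b5
  linarith

end TestFunctions

/-! ### Displaced measures, optimality of the displacement plans -/

section Displacement

variable {d : ℕ} {φ : Eu d → ℝ}

lemma lintegral_enorm_sq_eq {α E : Type*} [MeasurableSpace α] [NormedAddCommGroup E]
    (f : α → E) (μ : Measure α) : ∫⁻ x, ‖f x‖ₑ ^ 2 ∂μ = eLpNorm f 2 μ ^ 2 := by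
  have := eLpNorm_nnreal_pow_eq_lintegral (μ := μ) (f := f) (p := 2) (by simp)
  simpa using this.symm

lemma lintegral_enorm_sq_lt_top_iff {α E : Type*} [MeasurableSpace α] [NormedAddCommGroup E]
    (f : α → E) (μ : Measure α) : ∫⁻ x, ‖f x‖ₑ ^ 2 ∂μ < ⊤ ↔ eLpNorm f 2 μ < ⊤ := by
  rw [lintegral_enorm_sq_eq]
  simp [ENNReal.pow_lt_top_iff]

lemma P2.memLp_id (μ : P2 d) : MemLp (fun x : Eu d => x) 2 μ.meas :=
  ⟨continuous_id.aestronglyMeasurable, (lintegral_enorm_sq_lt_top_iff _ _).1 μ.2.2⟩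

lemma memLp_shift (hφ : ContDiff ℝ ∞ φ) (hc : HasCompactSupport φ) (μ : P2 d) (s : ℝ) :
    MemLp (shift φ s) 2 μ.meas :=
  μ.memLp_id.add ((memLp_gradient hφ hc μ.meas).const_smul s)

/-- The image of `μ` under `shift φ s`. -/
def displace (hφ : ContDiff ℝ ∞ φ) (hc : HasCompactSupport φ) (μ : P2 d) (s : ℝ) : P2 d :=
  ⟨μ.meas.map (shift φ s),
    Measure.isProbabilityMeasure_map (continuous_shift hφ s).aemeasurable, by
      have hm := (continuous_shift hφ s).measurable
      rw [lintegral_map (by fun_prop) hm, lintegral_enorm_sq_lt_top_iff]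
      exact (memLp_shift hφ hc μ s).2⟩

lemma displace_meas (hφ : ContDiff ℝ ∞ φ) (hc : HasCompactSupport φ) (μ : P2 d) (s : ℝ) :
    (displace hφ hc μ s).meas = μ.meas.map (shift φ s) := rfl

lemma displace_zero (hφ : ContDiff ℝ ∞ φ) (hc : HasCompactSupport φ) (μ : P2 d) :
    displace hφ hc μ 0 = μ := by
  apply Subtype.ext
  change μ.meas.map (shift φ 0) = μ.meas
  have : shift φ 0 = id := funext shift_zero
  rw [this, Measure.map_id]

/-- The plan between `displace μ s` and `displace μ t` that moves along `∇φ`. -/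
def displacePlan (φ : Eu d → ℝ) (μ : P2 d) (s t : ℝ) : Measure (Eu d × Eu d) :=
  μ.meas.map fun x => (shift φ s x, shift φ t x)

lemma displacePlan_mem_couplings (hφ : ContDiff ℝ ∞ φ) (hc : HasCompactSupport φ) (μ : P2 d)
    (s t : ℝ) :
    displacePlan φ μ s t ∈ couplings (displace hφ hc μ s) (displace hφ hc μ t) := by
  have hs := (continuous_shift hφ s).measurable
  have ht := (continuous_shift hφ t).measurable
  constructor
  · rw [displacePlan, Measure.map_map measurable_fst (hs.prodMk ht)]; rfl
  · rw [displacePlan, Measure.map_map measurable_snd (hs.prodMk ht)]; rfl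

lemma cost_displacePlan (hφ : ContDiff ℝ ∞ φ) (hc : HasCompactSupport φ) (μ : P2 d) (s h : ℝ) :
    cost (displacePlan φ μ s (s + h))
      = ENNReal.ofReal (∫ x, h ^ 2 * ‖gradient φ x‖ ^ 2 ∂μ.meas) := by
  have hs := (continuous_shift hφ s).measurable
  have ht := (continuous_shift hφ (s + h)).measurable
  have hint : Integrable (fun x => h ^ 2 * ‖gradient φ x‖ ^ 2) μ.meas :=
    ((memLp_gradient hφ hc μ.meas).integrable_norm_pow (p := 2) (by simp)).const_mul _
  rw [cost, displacePlan, lintegral_map (by fun_prop) (hs.prodMk ht),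
    ofReal_integral_eq_lintegral_ofReal hint (ae_of_all _ fun x => by positivity)]
  congr 1 with x
  have : shift φ s x - shift φ (s + h) x = -(h • gradient φ x) := by
    simp only [shift]; module
  rw [this, enorm_neg, ← ofReal_norm, ← ENNReal.ofReal_pow (norm_nonneg _), norm_smul,
    mul_pow, Real.norm_eq_abs, sq_abs]

/-- Moving along a gradient field with small step is optimal, also when starting from a measure
that has already been moved. -/
lemma displacePlan_mem_optimalPlans (hφ : ContDiff ℝ ∞ φ) (hc : HasCompactSupport φ) (μ : P2 d)
    {L : ℝ} (hL0 : 0 < L) (hL : ∀ x y, ‖gradient φ x - gradient φ y‖ ≤ L * ‖x - y‖)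
    {s h : ℝ} (hs : |s| * L ≤ 1 / 4) (hh : 16 * |h| * L ≤ 1) :
    displacePlan φ μ s (s + h)
      ∈ optimalPlans (displace hφ hc μ s) (displace hφ hc μ (s + h)) := by
  refine ⟨displacePlan_mem_couplings hφ hc μ s (s + h), fun γ hγ => ?_⟩
  -- The bound 1/4 on |s|L leaves room for the step, since 1/4 + 1/16 ≤ 1/2; both endpoint maps are
  -- therefore injective.
  have hsh : |s + h| * L ≤ 1 / 2 := by
    nlinarith [abs_add_le s h]
  have hs2 : |s| * L ≤ 1 / 2 := by linarith
  -- Measurable left inverses `a`, `b` of the two shifts carry both marginals of an arbitrary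
  -- competitor `γ` back to `μ`.
  obtain ⟨a, ham, ha⟩ := (measurableEmbedding_shift hφ hL hs2).exists_measurable_extend
    measurable_id (fun x => ⟨x⟩)
  obtain ⟨b, hbm, hb⟩ := (measurableEmbedding_shift hφ hL hsh).exists_measurable_extend
    measurable_id (fun x => ⟨x⟩)
  have hSm := (continuous_shift hφ s).measurable
  have hTm := (continuous_shift hφ (s + h)).measurable
  obtain ⟨h1, h2⟩ := hγ
  rw [displace_meas] at h1 h2
  have hγa : γ.map (fun p => a p.1) = μ.meas := by
    rw [show (fun p : Eu d × Eu d => a p.1) = a ∘ Prod.fst from rfl,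
      ← Measure.map_map ham measurable_fst, h1, Measure.map_map ham hSm, ha, Measure.map_id]
  have hγb : γ.map (fun p => b p.2) = μ.meas := by
    rw [show (fun p : Eu d × Eu d => b p.2) = b ∘ Prod.snd from rfl,
      ← Measure.map_map hbm measurable_snd, h2, Measure.map_map hbm hTm, hb, Measure.map_id]
  have hra : ∀ᵐ p ∂γ, shift φ s (a p.1) = p.1 := by
    have : ∀ᵐ y ∂(γ.map Prod.fst), shift φ s (a y) = y := by
      have hset : MeasurableSet {y | shift φ s (a y) = y} :=
        measurableSet_eq_fun (hSm.comp ham) measurable_id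
      rw [h1, ae_map_iff hSm.aemeasurable hset]
      exact ae_of_all _ fun x => by rw [show a (shift φ s x) = x from congrFun ha x]
    exact ae_of_ae_map measurable_fst.aemeasurable this
  have hrb : ∀ᵐ p ∂γ, shift φ (s + h) (b p.2) = p.2 := by
    have : ∀ᵐ y ∂(γ.map Prod.snd), shift φ (s + h) (b y) = y := by
      have hset : MeasurableSet {y | shift φ (s + h) (b y) = y} :=
        measurableSet_eq_fun (hTm.comp hbm) measurable_id
      rw [h2, ae_map_iff hTm.aemeasurable hset]
      exact ae_of_all _ fun x => by rw [show b (shift φ (s + h) x) = x from congrFun hb x]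
    exact ae_of_ae_map measurable_snd.aemeasurable this
  by_cases hcost : cost γ = ⊤
  · rw [hcost]; exact le_top
  have : IsProbabilityMeasure γ := by
    have : IsProbabilityMeasure (γ.map (fun p => a p.1)) := by rw [hγa]; infer_instance
    exact Measure.isProbabilityMeasure_of_map (fun p : Eu d × Eu d => a p.1)
  have hmem : MemLp (fun p : Eu d × Eu d => p.1 - p.2) 2 γ :=
    ⟨(continuous_fst.sub continuous_snd).aestronglyMeasurable,
      (lintegral_enorm_sq_lt_top_iff _ _).1 (lt_top_iff_ne_top.2 hcost)⟩
  have hint : Integrable (fun p : Eu d × Eu d => ‖p.1 - p.2‖ ^ 2) γ :=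
    hmem.integrable_norm_pow (p := 2) (by simp)
  obtain ⟨hwc, A, hA⟩ := movedPotential_bound hφ hc s
  have hma : Measurable (fun p : Eu d × Eu d => a p.1) := ham.comp measurable_fst
  have hmb : Measurable (fun p : Eu d × Eu d => b p.2) := hbm.comp measurable_snd
  have hwa : Integrable (fun p : Eu d × Eu d => movedPotential φ s (a p.1)) γ :=
    Integrable.of_bound (hwc.measurable.comp hma).aestronglyMeasurable A (ae_of_all _ fun _ => hA _)
  have hwb : Integrable (fun p : Eu d × Eu d => movedPotential φ s (b p.2)) γ :=
    Integrable.of_bound (hwc.measurable.comp hmb).aestronglyMeasurable A (ae_of_all _ fun _ => hA _)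
  have hIa : ∫ p, movedPotential φ s (a p.1) ∂γ = ∫ x, movedPotential φ s x ∂μ.meas := by
    rw [← hγa, integral_map hma.aemeasurable hwc.aestronglyMeasurable]
  have hIb : ∫ p, movedPotential φ s (b p.2) ∂γ = ∫ x, movedPotential φ s x ∂μ.meas := by
    rw [← hγb, integral_map hmb.aemeasurable hwc.aestronglyMeasurable]
  have hgc : Continuous fun x => h ^ 2 * ‖gradient φ x‖ ^ 2 :=
    continuous_const.mul ((contDiff_gradient hφ).continuous.norm.pow 2)
  have hIg : ∫ p, h ^ 2 * ‖gradient φ (b p.2)‖ ^ 2 ∂γ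
      = ∫ x, h ^ 2 * ‖gradient φ x‖ ^ 2 ∂μ.meas := by
    rw [← hγb, integral_map hmb.aemeasurable hgc.aestronglyMeasurable]
  have hgi : Integrable (fun p : Eu d × Eu d => h ^ 2 * ‖gradient φ (b p.2)‖ ^ 2) γ := by
    have : Integrable (fun x => h ^ 2 * ‖gradient φ x‖ ^ 2) (γ.map (fun p => b p.2)) := by
      rw [hγb]
      exact ((memLp_gradient hφ hc μ.meas).integrable_norm_pow (p := 2) (by simp)).const_mul _
    exact this.comp_measurable hmb
  rw [cost_displacePlan hφ hc, ← hIg]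
  have hle : ∫ p, h ^ 2 * ‖gradient φ (b p.2)‖ ^ 2 ∂γ ≤ ∫ p, ‖p.1 - p.2‖ ^ 2 ∂γ := by
    have hd : Integrable (fun p : Eu d × Eu d =>
        2 * h * (movedPotential φ s (a p.1) - movedPotential φ s (b p.2))) γ :=
      (hwa.sub hwb).const_mul _
    -- The pointwise certificate at x = a(p.1), z = b(p.2). Both points have law `μ` under `γ`, so
    -- the potential terms cancel after integration.
    have : ∫ p, h ^ 2 * ‖gradient φ (b p.2)‖ ^ 2 ∂γ ≤ ∫ p, (‖p.1 - p.2‖ ^ 2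
        + 2 * h * (movedPotential φ s (a p.1) - movedPotential φ s (b p.2))) ∂γ := by
      refine integral_mono_ae hgi (hint.add hd) ?_
      filter_upwards [hra, hrb] with p hp1 hp2
      have := sq_norm_le_shift_sub_shift hφ hL0 hL hs2 hh (a p.1) (b p.2)
      rwa [hp1, hp2] at this
    rwa [integral_add hint hd, integral_const_mul (2 * h), integral_sub hwa hwb, hIa, hIb,
      sub_self, mul_zero, add_zero] at this
  refine (ENNReal.ofReal_le_ofReal hle).trans ?_
  rw [ofReal_integral_eq_lintegral_ofReal hint (ae_of_all _ fun x => by positivity)]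
  refine le_of_eq (lintegral_congr fun p => ?_)
  rw [← ofReal_norm, ← ENNReal.ofReal_pow (norm_nonneg _)]

lemma W2_sq_displace (hφ : ContDiff ℝ ∞ φ) (hc : HasCompactSupport φ) (μ : P2 d)
    {L : ℝ} (hL0 : 0 < L) (hL : ∀ x y, ‖gradient φ x - gradient φ y‖ ≤ L * ‖x - y‖)
    {s h : ℝ} (hs : |s| * L ≤ 1 / 4) (hh : 16 * |h| * L ≤ 1) :
    W2 (displace hφ hc μ s) (displace hφ hc μ (s + h)) ^ 2
      = h ^ 2 * ∫ x, ‖gradient φ x‖ ^ 2 ∂μ.meas := by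
  have hopt := displacePlan_mem_optimalPlans hφ hc μ hL0 hL hs hh
  have : (⨅ γ ∈ couplings (displace hφ hc μ s) (displace hφ hc μ (s + h)), cost γ)
      = cost (displacePlan φ μ s (s + h)) :=
    le_antisymm (iInf₂_le _ hopt.1) (le_iInf₂ hopt.2)
  have h0 : 0 ≤ ∫ x, h ^ 2 * ‖gradient φ x‖ ^ 2 ∂μ.meas := integral_nonneg fun x => by positivity
  rw [W2, this, Real.sq_sqrt ENNReal.toReal_nonneg, cost_displacePlan hφ hc,
    ENNReal.toReal_ofReal h0, integral_const_mul]

end Displacement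

/-! ### First-order calculus along displacements and the critical point equation -/

section FirstOrder

section SquareIntegrable

variable {α E : Type*} [MeasurableSpace α] {μ : Measure α} [NormedAddCommGroup E]
  [InnerProductSpace ℝ E] {f g : α → E}

lemma eLpNorm_inner_le (hf : AEStronglyMeasurable f μ) (hg : AEStronglyMeasurable g μ) :
    eLpNorm (fun x => ⟪f x, g x⟫) 1 μ ≤ eLpNorm f 2 μ * eLpNorm g 2 μ := by
  have := eLpNorm_le_eLpNorm_mul_eLpNorm_of_nnnorm (p := 2) (q := 2) (r := 1) hf hg
    (fun a b : E => ⟪a, b⟫) 1 (ae_of_all _ fun x => by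
      rw [one_mul]; exact nnnorm_inner_le_nnnorm _ _)
  simpa using this

lemma integrable_inner_of_memLp (hf : MemLp f 2 μ) (hg : MemLp g 2 μ) :
    Integrable (fun x => ⟪f x, g x⟫) μ :=
  memLp_one_iff_integrable.1 ⟨hf.1.inner hg.1,
    (eLpNorm_inner_le hf.1 hg.1).trans_lt (ENNReal.mul_lt_top hf.2 hg.2)⟩

lemma enorm_integral_inner_le (hf : AEStronglyMeasurable f μ) (hg : AEStronglyMeasurable g μ) :
    ‖∫ x, ⟪f x, g x⟫ ∂μ‖ₑ ≤ eLpNorm f 2 μ * eLpNorm g 2 μ := by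
  refine (enorm_integral_le_lintegral_enorm _).trans ?_
  rw [← eLpNorm_one_eq_lintegral_enorm]
  exact eLpNorm_inner_le hf hg

end SquareIntegrable

variable {d : ℕ} {φ : Eu d → ℝ}

/-- If `m` is orthogonal to the pullbacks of all smooth gradients, then it is orthogonal to the
pullbacks of all tangent fields. -/
lemma InTangent.integral_inner_comp_eq_zero {μ ν : P2 d} {ξ m S : Eu d → Eu d}
    (hξ : InTangent ν ξ) (hS : Measurable S) (hν : ν.meas = μ.meas.map S) (hm : MemLp m 2 μ.meas)
    (h : ∀ ψ : Eu d → ℝ, ContDiff ℝ ∞ ψ → HasCompactSupport ψ →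
      ∫ x, ⟪gradient ψ (S x), m x⟫ ∂μ.meas = 0) :
    ∫ x, ⟪ξ (S x), m x⟫ ∂μ.meas = 0 := by
  rw [← enorm_eq_zero]
  have hcomp : ∀ {f : Eu d → Eu d}, MemLp f 2 ν.meas → MemLp (fun x => f (S x)) 2 μ.meas := by
    intro f hf
    rw [hν] at hf
    exact hf.comp_of_map hS.aemeasurable
  have key : ∀ ε : ℝ≥0∞, 0 < ε →
      ‖∫ x, ⟪ξ (S x), m x⟫ ∂μ.meas‖ₑ ≤ ε * eLpNorm m 2 μ.meas := by
    intro ε hε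
    obtain ⟨ψ, hψ, hψc, hlt⟩ := hξ.2 ε hε
    have h1 := hcomp hξ.1
    have hg := memLp_gradient hψ hψc (p := 2) ν.meas
    have h2 := hcomp hg
    have e : ∫ x, ⟪ξ (S x), m x⟫ ∂μ.meas = ∫ x, ⟪ξ (S x) - gradient ψ (S x), m x⟫ ∂μ.meas := by
      simp_rw [inner_sub_left]
      rw [integral_sub (integrable_inner_of_memLp h1 hm) (integrable_inner_of_memLp h2 hm),
        h ψ hψ hψc, sub_zero]
    rw [e]
    refine (enorm_integral_inner_le (h1.sub h2).1 hm.1).trans ?_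
    gcongr
    refine le_trans (le_of_eq ?_) hlt.le
    have hsub := (hξ.1.sub hg).1
    rw [hν] at hsub ⊢
    exact (eLpNorm_map_measure hsub hS.aemeasurable).symm
  by_contra hne
  obtain ⟨ε, hε, hlt⟩ := ENNReal.exists_pos_mul_lt hm.2.ne hne
  exact absurd (key ε hε) (not_le.2 hlt)

lemma InTangent.integral_inner_eq_zero {μ : P2 d} {ξ m : Eu d → Eu d}
    (hξ : InTangent μ ξ) (hm : MemLp m 2 μ.meas)
    (h : ∀ ψ : Eu d → ℝ, ContDiff ℝ ∞ ψ → HasCompactSupport ψ →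
      ∫ x, ⟪gradient ψ x, m x⟫ ∂μ.meas = 0) :
    ∫ x, ⟪ξ x, m x⟫ ∂μ.meas = 0 :=
  hξ.integral_inner_comp_eq_zero (S := id) measurable_id (by rw [Measure.map_id]) hm h

/-- First order expansion of a functional along a displacement. -/
lemma IsWGradientWith.abs_displace_le (hφ : ContDiff ℝ ∞ φ) (hc : HasCompactSupport φ) {μ : P2 d}
    {L : ℝ} (hL0 : 0 < L) (hL : ∀ x y, ‖gradient φ x - gradient φ y‖ ≤ L * ‖x - y‖)
    {s h : ℝ} (hs : |s| * L ≤ 1 / 4) (hh : 16 * |h| * L ≤ 1)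
    {Φ : P2 d → ℝ} {ξ : Eu d → Eu d} {C r : ℝ} (hr : 0 < r)
    (hΦ : IsWGradientWith Φ (displace hφ hc μ s) ξ C r)
    (hhr : h ^ 2 * ∫ x, ‖gradient φ x‖ ^ 2 ∂μ.meas < r ^ 2) :
    |Φ (displace hφ hc μ (s + h)) - Φ (displace hφ hc μ s)
        - h * ∫ x, ⟪ξ (shift φ s x), gradient φ x⟫ ∂μ.meas|
      ≤ C * (h ^ 2 * ∫ x, ‖gradient φ x‖ ^ 2 ∂μ.meas) := by
  have hW := W2_sq_displace hφ hc μ hL0 hL hs hh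
  have hlt : W2 (displace hφ hc μ s) (displace hφ hc μ (s + h)) < r :=
    lt_of_pow_lt_pow_left₀ 2 hr.le (by rw [hW]; exact hhr)
  have hmain := hΦ.2 _ hlt _ (displacePlan_mem_optimalPlans hφ hc μ hL0 hL hs hh)
  have hSm := (continuous_shift hφ s).measurable
  have hTm := (continuous_shift hφ (s + h)).measurable
  have hξm : AEStronglyMeasurable (fun p : Eu d × Eu d => ξ p.1) (displacePlan φ μ s (s + h)) := by
    have h1 := (displacePlan_mem_couplings hφ hc μ s (s + h)).1
    have h2 := hΦ.1.1.1
    rw [← h1] at h2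
    exact h2.comp_measurable measurable_fst
  have hint : ∫ p, ⟪ξ p.1, p.2 - p.1⟫ ∂(displacePlan φ μ s (s + h))
      = h * ∫ x, ⟪ξ (shift φ s x), gradient φ x⟫ ∂μ.meas := by
    have hm : AEStronglyMeasurable (fun p : Eu d × Eu d => ⟪ξ p.1, p.2 - p.1⟫)
        (displacePlan φ μ s (s + h)) :=
      hξm.inner (continuous_snd.sub continuous_fst).aestronglyMeasurable
    rw [displacePlan] at hm ⊢
    rw [integral_map (hSm.prodMk hTm).aemeasurable hm, ← integral_const_mul]
    congr 1 with x
    have : shift φ (s + h) x - shift φ s x = h • gradient φ x := by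
      simp only [shift]; module
    rw [this, inner_smul_right]
  rwa [hW, hint] at hmain

lemma eventually_abs_mul_le {a b : ℝ} (hb : 0 < b) : ∀ᶠ h : ℝ in 𝓝 0, |h| * a ≤ b := by
  have : Tendsto (fun h : ℝ => |h| * a) (𝓝 0) (𝓝 (|0| * a)) :=
    (continuous_abs.mul continuous_const).tendsto 0
  rw [abs_zero, zero_mul] at this
  exact this.eventually_le_const hb

lemma eventually_sq_mul_lt {a b : ℝ} (hb : 0 < b) : ∀ᶠ h : ℝ in 𝓝 0, h ^ 2 * a < b := by
  have : Tendsto (fun h : ℝ => h ^ 2 * a) (𝓝 0) (𝓝 (0 ^ 2 * a)) :=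
    ((continuous_id.pow 2).mul continuous_const).tendsto 0
  rw [zero_pow two_ne_zero, zero_mul] at this
  exact this.eventually_lt_const hb

lemma eventually_small_step {L : ℝ} : ∀ᶠ h : ℝ in 𝓝 0, 16 * |h| * L ≤ 1 := by
  filter_upwards [eventually_abs_mul_le (a := 16 * L) one_pos] with h hh
  linarith

/-- Along the curve the error O(W₂²) is O(h²). The base point is a general small `s`, not only 0,
because monotonicity of F(μ_s) on an interval is needed later. -/
lemma IsWGradient.hasDerivAt_displace (hφ : ContDiff ℝ ∞ φ) (hc : HasCompactSupport φ) {μ : P2 d}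
    {L : ℝ} (hL0 : 0 < L) (hL : ∀ x y, ‖gradient φ x - gradient φ y‖ ≤ L * ‖x - y‖)
    {s : ℝ} (hs : |s| * L ≤ 1 / 4) {Φ : P2 d → ℝ} {ξ : Eu d → Eu d}
    (hΦ : IsWGradient Φ (displace hφ hc μ s) ξ) :
    HasDerivAt (fun t => Φ (displace hφ hc μ t))
      (∫ x, ⟪ξ (shift φ s x), gradient φ x⟫ ∂μ.meas) s := by
  obtain ⟨C, r, hr, hΦ⟩ := hΦ
  rw [hasDerivAt_iff_isLittleO_nhds_zero]
  have hO : (fun h : ℝ => Φ (displace hφ hc μ (s + h)) - Φ (displace hφ hc μ s)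
      - h • ∫ x, ⟪ξ (shift φ s x), gradient φ x⟫ ∂μ.meas) =O[𝓝 0] fun h => h ^ 2 := by
    refine Asymptotics.IsBigO.of_bound (C * ∫ x, ‖gradient φ x‖ ^ 2 ∂μ.meas) ?_
    filter_upwards [eventually_small_step (L := L),
      eventually_sq_mul_lt (a := ∫ x, ‖gradient φ x‖ ^ 2 ∂μ.meas) (sq_pos_of_pos hr)]
      with h h1 h2
    have := hΦ.abs_displace_le hφ hc hL0 hL hs h1 hr h2
    rw [Real.norm_eq_abs, Real.norm_eq_abs, abs_of_nonneg (sq_nonneg h), smul_eq_mul]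
    linarith
  refine hO.trans_isLittleO ?_
  simpa using Asymptotics.isLittleO_pow_pow (𝕜 := ℝ) (m := 1) (n := 2) one_lt_two

lemma IsW2LocalMin.eventually_le_displace (hφ : ContDiff ℝ ∞ φ) (hc : HasCompactSupport φ)
    {μ : P2 d} {F : P2 d → ℝ} (hmin : IsW2LocalMin F μ) :
    ∀ᶠ s in 𝓝 (0 : ℝ), F μ ≤ F (displace hφ hc μ s) := by
  obtain ⟨r, hr, hmin⟩ := hmin
  obtain ⟨L, hL0, hL⟩ := exists_lipschitz_gradient hφ hc
  filter_upwards [eventually_small_step (L := L), eventually_abs_mul_le (a := L) (b := 1 / 4)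
      (by norm_num), eventually_sq_mul_lt (a := ∫ x, ‖gradient φ x‖ ^ 2 ∂μ.meas)
      (sq_pos_of_pos hr)] with s h1 h2 h3
  refine hmin _ ?_
  -- Minimality has the moved measure as first argument of `W2`, so the step is -s from base s;
  -- symmetry of `W2` is not needed.
  have hW := W2_sq_displace hφ hc μ hL0 hL (h := -s) h2 (by rwa [abs_neg])
  rw [add_neg_cancel, displace_zero, neg_sq] at hW
  exact lt_of_pow_lt_pow_left₀ 2 hr.le (by rwa [hW])

/-- The Wasserstein gradient vanishes at a local minimum. -/
lemma IsW2LocalMin.gradient_ae_eq_zero {μ : P2 d} {F : P2 d → ℝ} (hmin : IsW2LocalMin F μ)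
    {ξ : Eu d → Eu d} (hξ : IsWGradient F μ ξ) : ∀ᵐ x ∂μ.meas, ξ x = 0 := by
  have htan : InTangent μ ξ := by
    obtain ⟨_, _, _, h⟩ := hξ
    exact h.1
  have horth : ∀ ψ : Eu d → ℝ, ContDiff ℝ ∞ ψ → HasCompactSupport ψ →
      ∫ x, ⟪gradient ψ x, ξ x⟫ ∂μ.meas = 0 := by
    intro ψ hψ hc
    obtain ⟨L, hL0, hL⟩ := exists_lipschitz_gradient hψ hc
    have hd := IsWGradient.hasDerivAt_displace hψ hc (μ := μ) hL0 hL (s := 0) (by simp)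
      (by rw [displace_zero]; exact hξ)
    have hlm : IsLocalMin (fun t => F (displace hψ hc μ t)) 0 := by
      have := hmin.eventually_le_displace hψ hc
      simpa [IsLocalMin, IsMinFilter, displace_zero] using this
    have := hlm.hasDerivAt_eq_zero hd
    simp_rw [shift_zero] at this
    simp_rw [real_inner_comm]
    exact this
  -- Being tangent, ξ is a limit of gradients, to all of which it is orthogonal; so it is orthogonal
  -- to itself.
  have h0 := htan.integral_inner_eq_zero htan.1 horth
  rw [integral_eq_zero_iff_of_nonneg (fun x => real_inner_self_nonneg)
    (integrable_inner_of_memLp htan.1 htan.1)] at h0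
  filter_upwards [h0] with x hx
  exact inner_self_eq_zero.1 hx

/-- The derivative of a differentiable map vanishes almost everywhere on its zero set. -/
lemma ae_fderiv_eq_zero_of_ae_eq_zero {f : Eu d → Eu d} (hf : Differentiable ℝ f)
    {μ : Measure (Eu d)} (hac : μ ≪ volume) (h0 : ∀ᵐ x ∂μ, f x = 0) :
    ∀ᵐ x ∂μ, fderiv ℝ f x = 0 := by
  have hs : MeasurableSet {x | f x = 0} :=
    (isClosed_eq hf.continuous continuous_const).measurableSet
  -- On its zero set `f` agrees with the linear map 0 with error constant 0, so at almost every
  -- point of that set the derivative is within 0 of 0. Absolute continuity transfers this to `μ`.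
  have happ : ApproximatesLinearOn f (0 : Eu d →L[ℝ] Eu d) {x | f x = 0} 0 := by
    intro x hx y hy
    simp only [Set.mem_ofPred_eq] at hx hy
    simp [hx, hy]
  have h := happ.norm_fderiv_sub_le volume hs (fderiv ℝ f)
    (fun x _ => hf.differentiableAt.hasFDerivAt.hasFDerivWithinAt)
  rw [ae_restrict_iff' hs] at h
  filter_upwards [hac.ae_le h, h0] with x hx hx0
  simpa using hx hx0

end FirstOrder

/-! ### Second-order expansion at a local minimum -/

section SecondOrder

variable {d : ℕ} {φ : Eu d → ℝ}

lemma norm_le_card_mul {v : Eu d} {a : ℝ} (h : ∀ i, |v i| ≤ a) : ‖v‖ ≤ d * a := by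
  have hv : v = ∑ i, EuclideanSpace.single i (v i) := by
    ext j
    simp [Finset.sum_apply]
  calc ‖v‖ = ‖∑ i, EuclideanSpace.single i (v i)‖ := by rw [← hv]
    _ ≤ ∑ i, ‖EuclideanSpace.single i (v i)‖ := norm_sum_le _ _
    _ ≤ ∑ _i : Fin d, a := Finset.sum_le_sum fun i _ => by simpa using h i
    _ = d * a := by simp

/-- The field `x ↦ ∫ k(x, y) ∇φ(y) μ(dy)`. -/
def kernelField (μ : P2 d) (k : Eu d → Eu d → Matrix (Fin d) (Fin d) ℝ) (φ : Eu d → ℝ)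
    (x : Eu d) : Eu d :=
  WithLp.toLp 2 fun i => ∫ y, ⟪(WithLp.toLp 2 (k x y i) : Eu d), gradient φ y⟫ ∂μ.meas

/-- First order expansion of the Wasserstein gradient along a displacement, with an error that is
locally uniform and square integrable in the space variable. -/
lemma SufficientlySmooth.exists_expansion {F : P2 d → ℝ} {G : P2 d → Eu d → Eu d}
    {K : P2 d → Eu d → Eu d → Matrix (Fin d) (Fin d) ℝ} (hF : SufficientlySmooth F G K)
    (hφ : ContDiff ℝ ∞ φ) (hc : HasCompactSupport φ) (μ : P2 d) :
    ∃ c : Eu d → ℝ, Continuous c ∧ MemLp c 2 μ.meas ∧ ∀ᶠ s in 𝓝 (0 : ℝ), ∀ x,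
      ‖G (displace hφ hc μ s) x - G μ x - s • kernelField μ (K μ) φ x‖ ≤ c x * s ^ 2 := by
  obtain ⟨c, r, hcc, hcm, hr, hK⟩ := hF.hess μ
  obtain ⟨L, hL0, hL⟩ := exists_lipschitz_gradient hφ hc
  set A := ∫ x, ‖gradient φ x‖ ^ 2 ∂μ.meas with hA
  refine ⟨fun x => (d * A) * c x, continuous_const.mul hcc, hcm.const_mul _, ?_⟩
  filter_upwards [eventually_small_step (L := L), eventually_sq_mul_lt (a := A)
    (sq_pos_of_pos hr)] with s h1 h2 x
  have : ∀ i, |(G (displace hφ hc μ s) x - G μ x - s • kernelField μ (K μ) φ x) i|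
      ≤ c x * (s ^ 2 * A) := by
    intro i
    have h0 : IsWGradientWith (fun ν => G ν x i) (displace hφ hc μ 0)
        (fun y => WithLp.toLp 2 (K μ x y i)) (c x) r := by
      rw [displace_zero]; exact hK x i
    have := h0.abs_displace_le hφ hc hL0 hL (by simp) h1 hr h2
    simp_rw [zero_add, displace_zero, shift_zero] at this
    simpa [kernelField] using this
  refine (norm_le_card_mul this).trans (le_of_eq ?_)
  ring

/-- The difference quotients s⁻¹(g_s - g₀) are continuous and differ from `k` by at most s·c, with
`c` locally bounded, so they converge locally uniformly. Continuity of `k` allows its evaluation at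
the moved points. -/
lemma continuous_of_expansion {g : ℝ → Eu d → Eu d} {g₀ k : Eu d → Eu d} {c : Eu d → ℝ}
    (hg : ∀ s, Continuous (g s)) (hg₀ : Continuous g₀) (hc : Continuous c)
    (h : ∀ᶠ s in 𝓝 (0 : ℝ), ∀ x, ‖g s x - g₀ x - s • k x‖ ≤ c x * s ^ 2) : Continuous k := by
  refine continuous_of_locally_uniform_approx_of_continuousAt fun x u hu => ?_
  obtain ⟨ε, hε, hεu⟩ := Metric.mem_uniformity_dist.1 hu
  have hnear : ∀ᶠ y in 𝓝 x, c y < |c x| + 1 :=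
    hc.continuousAt.eventually_lt_const (lt_of_le_of_lt (le_abs_self _) (lt_add_one _))
  have h1 : ∀ᶠ s in 𝓝[>] (0 : ℝ), |s| * (|c x| + 1) ≤ ε / 2 :=
    (eventually_abs_mul_le (half_pos hε)).filter_mono nhdsWithin_le_nhds
  obtain ⟨s, hs1, hs2, hs⟩ := (h1.and ((h.filter_mono nhdsWithin_le_nhds).and
    (self_mem_nhdsWithin : Set.Ioi (0 : ℝ) ∈ 𝓝[>] 0))).exists
  have hs : 0 < s := hs
  refine ⟨_, hnear, fun y => s⁻¹ • (g s y - g₀ y), (((hg s).sub hg₀).const_smul s⁻¹).continuousAt, fun y hy => ?_⟩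
  refine hεu ?_
  have hy : c y < |c x| + 1 := hy
  have e : k y - s⁻¹ • (g s y - g₀ y) = -(s⁻¹ • (g s y - g₀ y - s • k y)) := by
    rw [smul_sub s⁻¹ _ (s • k y), smul_smul, inv_mul_cancel₀ hs.ne', one_smul]
    abel
  rw [dist_eq_norm, e, norm_neg, norm_smul, norm_inv, Real.norm_eq_abs, abs_of_pos hs]
  rw [abs_of_pos hs] at hs1
  calc s⁻¹ * ‖g s y - g₀ y - s • k y‖ ≤ s⁻¹ * (c y * s ^ 2) := by gcongr; exact hs2 y
    _ = s * c y := by field_simp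
    _ ≤ s * (|c x| + 1) := by gcongr
    _ < ε := by linarith

lemma exists_shift_eq_self (hc : HasCompactSupport φ) :
    ∃ R : ℝ, ∀ x, R < ‖x‖ → gradient φ x = 0 ∧ ∀ s, shift φ s x = x := by
  obtain ⟨R, hR⟩ := (hasCompactSupport_gradient hc).isCompact.isBounded.subset_closedBall 0
  refine ⟨R, fun x hx => ?_⟩
  have : gradient φ x = 0 := by
    by_contra hne
    have := hR (subset_tsupport _ (Function.mem_support.2 hne))
    rw [mem_closedBall_zero_iff] at this
    linarith
  exact ⟨this, fun s => by simp [shift, this]⟩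

lemma exists_closedBall_shift_mem (hφ : ContDiff ℝ ∞ φ) (hc : HasCompactSupport φ) :
    ∃ R : ℝ, ∀ x, (gradient φ x = 0 ∧ ∀ s, shift φ s x = x) ∨
      (x ∈ Metric.closedBall (0 : Eu d) R ∧
        ∀ s ∈ Set.Icc (0 : ℝ) 1, shift φ s x ∈ Metric.closedBall (0 : Eu d) R) := by
  obtain ⟨R, hR⟩ := exists_shift_eq_self hc
  obtain ⟨A, hA⟩ := exists_bound_gradient hφ hc
  have hA0 : 0 ≤ A := (norm_nonneg _).trans (hA 0)
  refine ⟨R + A, fun x => ?_⟩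
  rcases lt_or_ge R ‖x‖ with h | h
  · exact Or.inl (hR x h)
  · refine Or.inr ⟨by rw [mem_closedBall_zero_iff]; linarith, fun s hs => ?_⟩
    rw [mem_closedBall_zero_iff]
    refine (norm_add_le _ _).trans (add_le_add h ?_)
    rw [norm_smul, Real.norm_eq_abs, abs_of_nonneg hs.1]
    calc s * ‖gradient φ x‖ ≤ 1 * A := by gcongr; exacts [hs.2, hA x]
      _ = A := one_mul A

/-- Points move only inside a fixed ball, where `f` is bounded; elsewhere the shift is the identity.
This yields a dominating function uniform in `s`. -/
lemma exists_norm_comp_shift_le (hφ : ContDiff ℝ ∞ φ) (hc : HasCompactSupport φ) {E : Type*}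
    [NormedAddCommGroup E] {f : Eu d → E} (hf : Continuous f) :
    ∃ M : ℝ, ∀ s ∈ Set.Icc (0 : ℝ) 1, ∀ x, ‖f (shift φ s x)‖ ≤ M + ‖f x‖ := by
  obtain ⟨R, hR⟩ := exists_closedBall_shift_mem hφ hc
  obtain ⟨M, hM⟩ := (isCompact_closedBall (0 : Eu d) R).exists_bound_of_continuousOn hf.continuousOn
  refine ⟨max M 0, fun s hs x => ?_⟩
  rcases hR x with h | h
  · rw [h.2 s]; linarith [le_max_right M 0]
  · linarith [hM _ (h.2 s hs), le_max_left M 0, norm_nonneg (f x)]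

lemma exists_norm_comp_shift_sub_le (hφ : ContDiff ℝ ∞ φ) (hc : HasCompactSupport φ)
    {f : Eu d → Eu d} (hf : ContDiff ℝ 1 f) :
    ∃ M : ℝ, ∀ s ∈ Set.Icc (0 : ℝ) 1, ∀ x, ‖f (shift φ s x) - f x‖ ≤ M * s := by
  obtain ⟨R, hR⟩ := exists_closedBall_shift_mem hφ hc
  obtain ⟨A, hA⟩ := exists_bound_gradient hφ hc
  have hA0 : 0 ≤ A := (norm_nonneg _).trans (hA 0)
  obtain ⟨M, hM⟩ := (isCompact_closedBall (0 : Eu d) R).exists_bound_of_continuousOn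
    (hf.continuous_fderiv (by simp)).continuousOn
  refine ⟨max M 0 * A, fun s hs x => ?_⟩
  rcases hR x with h | h
  · rw [h.2 s, sub_self, norm_zero]
    exact mul_nonneg (mul_nonneg (le_max_right M 0) hA0) hs.1
  · have := (convex_closedBall (0 : Eu d) R).norm_image_sub_le_of_norm_fderiv_le (𝕜 := ℝ) (f := f)
      (fun y _ => (hf.differentiable (by simp)).differentiableAt)
      (fun y hy => (hM y hy).trans (le_max_left M 0)) h.1 (h.2 s hs)
    refine this.trans ?_
    have e : shift φ s x - x = s • gradient φ x := by simp [shift]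
    rw [e, norm_smul, Real.norm_eq_abs, abs_of_nonneg hs.1]
    calc max M 0 * (s * ‖gradient φ x‖) ≤ max M 0 * (s * A) := by
          gcongr
          exacts [hs.1, hA x]
      _ = _ := by ring

lemma tendsto_shift (x : Eu d) : Tendsto (fun s => shift φ s x) (𝓝[>] 0) (𝓝 x) := by
  have : Continuous fun s : ℝ => shift φ s x :=
    continuous_const.add (continuous_id.smul continuous_const)
  have h := this.tendsto 0
  rw [shift_zero] at h
  exact h.mono_left nhdsWithin_le_nhds

/-- Weak convergence of the difference quotients of fields along a displacement, when the limiting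
field vanishes to first order almost everywhere. -/
lemma tendsto_integral_inner_comp_shift (hφ : ContDiff ℝ ∞ φ) (hc : HasCompactSupport φ)
    {μ : P2 d} {g : ℝ → Eu d → Eu d} {g₀ k : Eu d → Eu d} {c : Eu d → ℝ}
    (hg : ∀ s, Continuous (g s)) (hg₀ : ContDiff ℝ 1 g₀) (hcc : Continuous c)
    (hcm : MemLp c 2 μ.meas) (hkm : MemLp k 2 μ.meas)
    (h : ∀ᶠ s in 𝓝 (0 : ℝ), ∀ x, ‖g s x - g₀ x - s • k x‖ ≤ c x * s ^ 2)
    (hzero : ∀ᵐ x ∂μ.meas, g₀ x = 0) (hderiv : ∀ᵐ x ∂μ.meas, fderiv ℝ g₀ x = 0)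
    {n : Eu d → Eu d} (hn : MemLp n 2 μ.meas) :
    Tendsto (fun s => ∫ x, ⟪s⁻¹ • g s (shift φ s x), n x⟫ ∂μ.meas) (𝓝[>] 0)
      (𝓝 (∫ x, ⟪k x, n x⟫ ∂μ.meas)) := by
  have hk : Continuous k := continuous_of_expansion hg hg₀.continuous hcc h
  obtain ⟨M₁, hM₁⟩ := exists_norm_comp_shift_le hφ hc hk
  obtain ⟨M₂, hM₂⟩ := exists_norm_comp_shift_le hφ hc hcc
  obtain ⟨M₃, hM₃⟩ := exists_norm_comp_shift_sub_le hφ hc hg₀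
  have hIoc : ∀ᶠ s in 𝓝[>] (0 : ℝ), s ∈ Set.Ioc (0 : ℝ) 1 := Ioc_mem_nhdsGT one_pos
  have h' := h.filter_mono (nhdsWithin_le_nhds (s := Set.Ioi (0 : ℝ)))
  -- The quotient splits as s⁻¹g₀(S_s x) + k(S_s x) + error. The three parts are dominated and sent
  -- to their limits separately.
  have herr : ∀ᶠ s in 𝓝[>] (0 : ℝ), ∀ x,
      ‖s⁻¹ • g s (shift φ s x) - s⁻¹ • g₀ (shift φ s x) - k (shift φ s x)‖
        ≤ s * ‖c (shift φ s x)‖ := by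
    filter_upwards [hIoc, h'] with s hs hsx x
    have e : s⁻¹ • g s (shift φ s x) - s⁻¹ • g₀ (shift φ s x) - k (shift φ s x)
        = s⁻¹ • (g s (shift φ s x) - g₀ (shift φ s x) - s • k (shift φ s x)) := by
      rw [smul_sub, smul_sub, smul_smul, inv_mul_cancel₀ hs.1.ne', one_smul]
    rw [e, norm_smul, norm_inv, Real.norm_eq_abs, abs_of_pos hs.1]
    have hs0 := hs.1
    calc s⁻¹ * _ ≤ s⁻¹ * (c (shift φ s x) * s ^ 2) := by gcongr; exact hsx _
      _ = s * c (shift φ s x) := by field_simp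
      _ ≤ _ := by gcongr; exact Real.le_norm_self _
  have hbm : MemLp (fun x => (M₃ + (M₁ + ‖k x‖)) + (M₂ + ‖c x‖)) 2 μ.meas :=
    ((memLp_const M₃).add ((memLp_const M₁).add hkm.norm)).add ((memLp_const M₂).add hcm.norm)
  refine tendsto_integral_filter_of_dominated_convergence
    (fun x => ((M₃ + (M₁ + ‖k x‖)) + (M₂ + ‖c x‖)) * ‖n x‖) ?_ ?_ ?_ ?_
  · refine Eventually.of_forall fun s => ?_
    have hm : AEStronglyMeasurable (fun x => s⁻¹ • g s (shift φ s x)) μ.meas :=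
      (((hg s).comp (continuous_shift hφ s)).const_smul s⁻¹).aestronglyMeasurable
    exact hm.inner hn.1
  · filter_upwards [hIoc, herr] with s hs herr
    filter_upwards [hzero] with x hx
    have hs1 : s ∈ Set.Icc (0 : ℝ) 1 := ⟨hs.1.le, hs.2⟩
    refine (norm_inner_le_norm _ _).trans ?_
    gcongr
    have e : s⁻¹ • g s (shift φ s x) = s⁻¹ • g₀ (shift φ s x) + k (shift φ s x)
        + (s⁻¹ • g s (shift φ s x) - s⁻¹ • g₀ (shift φ s x) - k (shift φ s x)) := by abel
    rw [e]
    refine (norm_add_le _ _).trans (add_le_add ((norm_add_le _ _).trans (add_le_add ?_ ?_)) ?_)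
    · have := hM₃ s hs1 x
      rw [hx, sub_zero] at this
      rw [norm_smul, norm_inv, Real.norm_eq_abs, abs_of_pos hs.1, inv_mul_le_iff₀ hs.1]
      linarith
    · exact hM₁ s hs1 x
    · refine (herr x).trans ((mul_le_of_le_one_left (norm_nonneg _) hs.2).trans (hM₂ s hs1 x))
  · exact hbm.integrable_mul hn.norm
  · filter_upwards [hzero, hderiv] with x hx hdx
    refine Tendsto.inner ?_ tendsto_const_nhds
    -- The limit is the derivative of g₀ along the curve, Dg₀(x)∇φ(x), which is zero at almost every
    -- x.
    have t1 : Tendsto (fun s : ℝ => s⁻¹ • g₀ (shift φ s x)) (𝓝[>] 0) (𝓝 0) := by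
      have hcurve : HasDerivAt (fun s : ℝ => shift φ s x) (gradient φ x) 0 := by
        have := ((hasDerivAt_id (0 : ℝ)).smul_const (gradient φ x)).const_add x
        simpa [shift] using this
      have hcomp : HasDerivAt (fun s : ℝ => g₀ (shift φ s x)) 0 0 := by
        have hd : HasFDerivAt g₀ (fderiv ℝ g₀ x) (shift φ 0 x) := by
          rw [shift_zero]
          exact (hg₀.differentiable (by simp)).differentiableAt.hasFDerivAt
        have := hd.comp_hasDerivAt (0 : ℝ) hcurve
        rwa [hdx, _root_.zero_apply] at this
      have := (hasDerivAt_iff_tendsto_slope_zero.1 hcomp).mono_left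
        (nhdsWithin_mono (0 : ℝ) (s := Set.Ioi 0) fun s hs => (Set.mem_Ioi.1 hs).ne')
      simpa [shift_zero, hx] using this
    have t2 : Tendsto (fun s : ℝ => k (shift φ s x)) (𝓝[>] 0) (𝓝 (k x)) :=
      (hk.tendsto x).comp (tendsto_shift x)
    have t3 : Tendsto (fun s : ℝ => s * ‖c (shift φ s x)‖) (𝓝[>] 0) (𝓝 0) := by
      have h1 : Tendsto (fun s : ℝ => s) (𝓝[>] 0) (𝓝 0) := tendsto_id.mono_left nhdsWithin_le_nhds
      have := h1.mul ((hcc.norm.tendsto x).comp (tendsto_shift (φ := φ) x))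
      simpa using this
    have t4 := squeeze_zero_norm' (herr.mono fun s hs => hs x) t3
    have := (t1.add t2).add t4
    simp only [zero_add, add_zero] at this
    refine this.congr fun s => ?_
    abel

section LocalMin

variable {F : P2 d → ℝ} {G : P2 d → Eu d → Eu d}
  {K : P2 d → Eu d → Eu d → Matrix (Fin d) (Fin d) ℝ} {μ : P2 d}

lemma SufficientlySmooth.tendsto_integral_inner (hF : SufficientlySmooth F G K)
    (hac : μ.meas ≪ volume) (hmin : IsW2LocalMin F μ)
    (hφ : ContDiff ℝ ∞ φ) (hc : HasCompactSupport φ)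
    (hk : MemLp (kernelField μ (K μ) φ) 2 μ.meas) {n : Eu d → Eu d} (hn : MemLp n 2 μ.meas) :
    Tendsto (fun s => ∫ x, ⟪s⁻¹ • G (displace hφ hc μ s) (shift φ s x), n x⟫ ∂μ.meas) (𝓝[>] 0)
      (𝓝 (∫ x, ⟪kernelField μ (K μ) φ x, n x⟫ ∂μ.meas)) := by
  obtain ⟨c, hcc, hcm, hexp⟩ := hF.exists_expansion hφ hc μ
  have h0 := hmin.gradient_ae_eq_zero (hF.grad μ)
  exact tendsto_integral_inner_comp_shift hφ hc (g := fun s => G (displace hφ hc μ s))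
    (fun s => (hF.contDiff _).continuous) (hF.contDiff μ) hcc hcm hk hexp h0
    (ae_fderiv_eq_zero_of_ae_eq_zero ((hF.contDiff μ).differentiable (by simp)) hac h0) hn

/-- The Hessian is nonnegative on gradients of test functions. -/
lemma SufficientlySmooth.integral_inner_kernelField_nonneg (hF : SufficientlySmooth F G K)
    (hac : μ.meas ≪ volume) (hmin : IsW2LocalMin F μ)
    (hφ : ContDiff ℝ ∞ φ) (hc : HasCompactSupport φ)
    (hk : MemLp (kernelField μ (K μ) φ) 2 μ.meas) :
    0 ≤ ∫ x, ⟪kernelField μ (K μ) φ x, gradient φ x⟫ ∂μ.meas := by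
  by_contra! hneg
  have hlim := hF.tendsto_integral_inner hac hmin hφ hc hk (memLp_gradient hφ hc μ.meas)
  obtain ⟨L, hL0, hL⟩ := exists_lipschitz_gradient hφ hc
  have hev := hlim.eventually_lt_const hneg
  have h1 := (eventually_abs_mul_le (a := L) (b := 1 / 4) (by norm_num)).filter_mono
    (nhdsWithin_le_nhds (s := Set.Ioi (0 : ℝ)))
  have h2 := (hmin.eventually_le_displace hφ hc).filter_mono
    (nhdsWithin_le_nhds (s := Set.Ioi (0 : ℝ)))
  obtain ⟨δ, hδ, hsub⟩ := mem_nhdsGT_iff_exists_Ioc_subset.1 (hev.and (h1.and h2))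
  have hδ : 0 < δ := hδ
  have hd : ∀ s ∈ Set.Icc (0 : ℝ) δ, HasDerivAt (fun t => F (displace hφ hc μ t))
      (∫ x, ⟪G (displace hφ hc μ s) (shift φ s x), gradient φ x⟫ ∂μ.meas) s := by
    intro s hs
    refine IsWGradient.hasDerivAt_displace hφ hc hL0 hL ?_ (hF.grad _)
    rcases hs.1.eq_or_lt with h | h
    · rw [← h]; simp
    · exact (hsub ⟨h, hs.2⟩).2.1
  have hanti : StrictAntiOn (fun t => F (displace hφ hc μ t)) (Set.Icc 0 δ) := by
    refine strictAntiOn_of_deriv_neg (convex_Icc _ _)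
      (fun s hs => (hd s hs).continuousAt.continuousWithinAt) fun s hs => ?_
    rw [interior_Icc] at hs
    rw [(hd s ⟨hs.1.le, hs.2.le⟩).deriv]
    -- The derivative of F(μ_s) is s times the converging quotient, whose limit was assumed
    -- negative.
    have hlt := (hsub ⟨hs.1, hs.2.le⟩).1
    simp only [real_inner_smul_left, integral_const_mul] at hlt
    exact neg_of_mul_neg_right hlt (inv_nonneg.2 hs.1.le)
  have hlt := hanti ⟨le_rfl, hδ.le⟩ ⟨hδ.le, le_rfl⟩ hδ
  have hge := (hsub ⟨hδ, le_rfl⟩).2.2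
  simp only [displace_zero] at hlt
  exact absurd hlt (not_lt.2 hge)

/-- The image under the Hessian of the gradient of a test function is tangent. -/
lemma SufficientlySmooth.integral_inner_kernelField_eq_zero (hF : SufficientlySmooth F G K)
    (hac : μ.meas ≪ volume) (hmin : IsW2LocalMin F μ)
    (hφ : ContDiff ℝ ∞ φ) (hc : HasCompactSupport φ)
    (hk : MemLp (kernelField μ (K μ) φ) 2 μ.meas) {n : Eu d → Eu d} (hn : MemLp n 2 μ.meas)
    (horth : ∀ ψ : Eu d → ℝ, ContDiff ℝ ∞ ψ → HasCompactSupport ψ →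
      ∫ x, ⟪gradient ψ x, n x⟫ ∂μ.meas = 0) :
    ∫ x, ⟪kernelField μ (K μ) φ x, n x⟫ ∂μ.meas = 0 := by
  have hgd : ContDiff ℝ ∞ (gradient φ) := contDiff_gradient hφ
  have hDc : Continuous (fderiv ℝ (gradient φ)) := hgd.continuous_fderiv (by simp)
  obtain ⟨B, hB⟩ := ((hasCompactSupport_gradient hc).fderiv ℝ).exists_bound_of_continuous hDc
  -- With N = D²φ n, the field n + sN is DS_s applied to n.
  set N : Eu d → Eu d := fun x => fderiv ℝ (gradient φ) x (n x) with hN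
  have hNm : MemLp N 2 μ.meas := by
    refine MemLp.of_le_mul (c := B) hn ?_ (ae_of_all _ fun x => ?_)
    · exact (ContinuousLinearMap.apply ℝ (Eu d)).aestronglyMeasurable_comp₂ hn.1
        hDc.aestronglyMeasurable
    · exact ((fderiv ℝ (gradient φ) x).le_opNorm _).trans (by gcongr; exact hB x)
  have hSd : ∀ s x, HasFDerivAt (shift φ s)
      (ContinuousLinearMap.id ℝ (Eu d) + s • fderiv ℝ (gradient φ) x) x := fun s x =>
    (hasFDerivAt_id x).add
      ((hgd.differentiable (by simp)).differentiableAt.hasFDerivAt.const_smul s)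
  -- By the chain rule the integrand is ⟨∇(ψ∘S_s), n⟩, and ψ∘S_s is again a test function.
  have hpull : ∀ s, ∀ ψ : Eu d → ℝ, ContDiff ℝ ∞ ψ → HasCompactSupport ψ →
      ∫ x, ⟪gradient ψ (shift φ s x), n x + s • N x⟫ ∂μ.meas = 0 := by
    intro s ψ hψ hψc
    obtain ⟨R, hR⟩ := exists_shift_eq_self hc
    obtain ⟨R', hR'⟩ := hψc.isCompact.isBounded.subset_closedBall 0
    have hcs : HasCompactSupport (ψ ∘ shift φ s) := by
      refine HasCompactSupport.intro (isCompact_closedBall (0 : Eu d) (max R R')) fun x hx => ?_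
      rw [mem_closedBall_zero_iff, not_le, max_lt_iff] at hx
      rw [Function.comp_apply, (hR x hx.1).2 s]
      by_contra hne
      have := hR' (subset_tsupport _ (Function.mem_support.2 hne))
      rw [mem_closedBall_zero_iff] at this
      linarith [hx.2]
    rw [← horth (ψ ∘ shift φ s) (hψ.comp (contDiff_shift hφ s)) hcs]
    congr 1 with x
    have hcomp := (hasFDerivAt_toDual_gradient hψ (shift φ s x)).comp x (hSd s x)
    have hu := (hasFDerivAt_toDual_gradient (hψ.comp (contDiff_shift hφ s)) x).unique hcomp
    have := congrArg (fun T => T (n x)) hu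
    simp only [ContinuousLinearMap.comp_apply, InnerProductSpace.toDual_apply_apply,
      _root_.add_apply, _root_.smul_apply,
      ContinuousLinearMap.id_apply] at this
    rw [this]
  -- Tangency of G(μ_s) at μ_s, divided by s. As s ↓ 0 the second integral stays convergent, so its
  -- factor s removes it.
  have hzero : ∀ s, ∫ x, ⟪s⁻¹ • G (displace hφ hc μ s) (shift φ s x), n x⟫ ∂μ.meas
      + s * ∫ x, ⟪s⁻¹ • G (displace hφ hc μ s) (shift φ s x), N x⟫ ∂μ.meas = 0 := by
    intro s
    have htan : InTangent (displace hφ hc μ s) (G (displace hφ hc μ s)) := by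
      obtain ⟨_, _, _, h⟩ := hF.grad (displace hφ hc μ s)
      exact h.1
    have hSm := (continuous_shift hφ s).measurable
    have hGm : MemLp (fun x => G (displace hφ hc μ s) (shift φ s x)) 2 μ.meas :=
      MemLp.comp_of_map (f := shift φ s) htan.1 hSm.aemeasurable
    have h0 := htan.integral_inner_comp_eq_zero hSm (displace_meas hφ hc μ s)
      (hn.add (hNm.const_smul s)) (hpull s)
    simp only [Pi.add_apply, Pi.smul_apply, inner_add_right, real_inner_smul_right] at h0
    rw [integral_add (integrable_inner_of_memLp hGm hn)
      ((integrable_inner_of_memLp hGm hNm).const_mul s), integral_const_mul] at h0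
    simp only [real_inner_smul_left, integral_const_mul]
    linear_combination s⁻¹ * h0
  have l1 := hF.tendsto_integral_inner hac hmin hφ hc hk hn
  have l2 := hF.tendsto_integral_inner hac hmin hφ hc hk hNm
  have l3 : Tendsto (fun s : ℝ => s) (𝓝[>] 0) (𝓝 0) := tendsto_id.mono_left nhdsWithin_le_nhds
  have l4 := l1.add (l3.mul l2)
  simp only [hzero, zero_mul, add_zero] at l4
  exact tendsto_nhds_unique l4 tendsto_const_nhds

end LocalMin

end SecondOrder

/-! ### The Hessian as a bounded operator, and its sign on L² -/

section HessianOperator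

section HilbertSchmidt

variable {α E : Type*} [MeasurableSpace α] {μ : Measure α} [NormedAddCommGroup E]
  [NormedSpace ℝ E] {κ : α × α → E →L[ℝ] E} {f : α → E}

lemma eLpNorm_apply_le {A : α → E →L[ℝ] E} (hA : AEStronglyMeasurable A μ)
    (hf : AEStronglyMeasurable f μ) :
    eLpNorm (fun y => A y (f y)) 1 μ ≤ eLpNorm A 2 μ * eLpNorm f 2 μ := by
  have := eLpNorm_le_eLpNorm_mul_eLpNorm_of_nnnorm (p := 2) (q := 2) (r := 1) hA hf
    (fun (T : E →L[ℝ] E) v => T v) 1 (ae_of_all _ fun x => by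
      rw [one_mul]; exact (A x).le_opNNNorm _)
  simpa using this

lemma aestronglyMeasurable_clm_apply {A : α → E →L[ℝ] E} (hA : AEStronglyMeasurable A μ)
    (hf : AEStronglyMeasurable f μ) : AEStronglyMeasurable (fun y => A y (f y)) μ :=
  (ContinuousLinearMap.apply ℝ E).aestronglyMeasurable_comp₂ hf hA

lemma integrable_clm_apply {A : α → E →L[ℝ] E} (hA : MemLp A 2 μ) (hf : MemLp f 2 μ) :
    Integrable (fun y => A y (f y)) μ :=
  memLp_one_iff_integrable.1 ⟨aestronglyMeasurable_clm_apply hA.1 hf.1,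
    (eLpNorm_apply_le hA.1 hf.1).trans_lt (ENNReal.mul_lt_top hA.2 hf.2)⟩

lemma memLp_sum_smul_vector {ι : Type*} [Fintype ι] {p : ℝ≥0∞} {a : α → ι → ι → ℝ}
    (ha : ∀ i j, MemLp (fun x => a x i j) p μ) (v : ι → ι → E) :
    MemLp (fun x => ∑ i, ∑ j, a x i j • v i j) p μ :=
  memLp_finsetSum _ fun i _ => memLp_finsetSum _ fun j _ =>
    (ContinuousLinearMap.toSpanSingleton ℝ (v i j)).comp_memLp' (ha i j)

variable [SFinite μ]

lemma ae_memLp_two_prodMk_left (hκ : MemLp κ 2 (μ.prod μ)) :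
    ∀ᵐ x ∂μ, MemLp (fun y => κ (x, y)) 2 μ := by
  filter_upwards [hκ.1.prodMk_left,
    (hκ.integrable_norm_pow (p := 2) (by simp)).prod_right_ae] with x h1 h2
  exact (memLp_two_iff_integrable_sq_norm h1).2 h2

lemma aestronglyMeasurable_integral_kernel (hκ : MemLp κ 2 (μ.prod μ)) (hf : MemLp f 2 μ) :
    AEStronglyMeasurable (fun x => ∫ y, κ (x, y) (f y) ∂μ) μ := by
  have h : AEStronglyMeasurable (fun p : α × α => κ p (f p.2)) (μ.prod μ) :=
    (ContinuousLinearMap.apply ℝ E).aestronglyMeasurable_comp₂ hf.1.comp_snd hκ.1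
  exact h.integral_prod_right'

/-- Hilbert–Schmidt bound: Cauchy–Schwarz in y for almost every x, then Tonelli. -/
lemma eLpNorm_integral_kernel_le (hκ : MemLp κ 2 (μ.prod μ)) (hf : MemLp f 2 μ) :
    eLpNorm (fun x => ∫ y, κ (x, y) (f y) ∂μ) 2 μ ≤ eLpNorm κ 2 (μ.prod μ) * eLpNorm f 2 μ := by
  rw [← ENNReal.pow_le_pow_left_iff two_ne_zero, mul_pow, ← lintegral_enorm_sq_eq,
    ← lintegral_enorm_sq_eq κ]
  have hm : AEMeasurable (fun p => ‖κ p‖ₑ ^ 2) (μ.prod μ) := hκ.1.enorm.pow_const 2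
  rw [lintegral_prod _ hm, ← lintegral_mul_const' _ _ (ENNReal.pow_ne_top hf.2.ne)]
  refine lintegral_mono_ae ?_
  filter_upwards [ae_memLp_two_prodMk_left hκ] with x hx
  rw [lintegral_enorm_sq_eq (fun y => κ (x, y)), ← mul_pow]
  gcongr
  refine (enorm_integral_le_lintegral_enorm _).trans ?_
  rw [← eLpNorm_one_eq_lintegral_enorm]
  exact eLpNorm_apply_le hx.1 hf.1

/-- An integral operator with square integrable kernel is bounded on `L²`. -/
lemma exists_integralOperator (hκ : MemLp κ 2 (μ.prod μ)) :
    ∃ T : Lp E 2 μ →L[ℝ] Lp E 2 μ, ∀ f, T f =ᵐ[μ] fun x => ∫ y, κ (x, y) (f y) ∂μ := by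
  have hmem : ∀ f : Lp E 2 μ, MemLp (fun x => ∫ y, κ (x, y) (f y) ∂μ) 2 μ := fun f =>
    ⟨aestronglyMeasurable_integral_kernel hκ (Lp.memLp f),
      (eLpNorm_integral_kernel_le hκ (Lp.memLp f)).trans_lt
        (ENNReal.mul_lt_top hκ.2 (Lp.memLp f).2)⟩
  let T₀ : Lp E 2 μ →ₗ[ℝ] Lp E 2 μ :=
    { toFun := fun f => (hmem f).toLp _
      map_add' := by
        intro f g
        apply Lp.ext
        filter_upwards [(hmem (f + g)).coeFn_toLp, Lp.coeFn_add ((hmem f).toLp _)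
          ((hmem g).toLp _), (hmem f).coeFn_toLp, (hmem g).coeFn_toLp,
          ae_memLp_two_prodMk_left hκ] with x h1 h2 h3 h4 h5
        rw [h1, h2, Pi.add_apply, h3, h4,
          ← integral_add (integrable_clm_apply h5 (Lp.memLp f))
            (integrable_clm_apply h5 (Lp.memLp g))]
        refine integral_congr_ae ?_
        filter_upwards [Lp.coeFn_add f g] with y hy
        rw [hy, Pi.add_apply, map_add]
      map_smul' := by
        intro a f
        apply Lp.ext
        filter_upwards [(hmem (a • f)).coeFn_toLp, Lp.coeFn_smul a ((hmem f).toLp _),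
          (hmem f).coeFn_toLp] with x h1 h2 h3
        rw [h1, RingHom.id_apply, h2, Pi.smul_apply, h3, ← integral_smul]
        refine integral_congr_ae ?_
        filter_upwards [Lp.coeFn_smul a f] with y hy
        rw [hy, Pi.smul_apply, map_smul] }
  refine ⟨T₀.mkContinuous (eLpNorm κ 2 (μ.prod μ)).toReal fun f => ?_,
    fun f => (hmem f).coeFn_toLp⟩
  change ‖(hmem f).toLp _‖ ≤ _
  rw [Lp.norm_toLp, Lp.norm_def, ← ENNReal.toReal_mul]
  exact ENNReal.toReal_mono (ENNReal.mul_lt_top hκ.2 (Lp.memLp f).2).ne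
    (eLpNorm_integral_kernel_le hκ (Lp.memLp f))

end HilbertSchmidt

variable {d : ℕ} {φ : Eu d → ℝ}

lemma memLp_toEuclideanCLM {α : Type*} [MeasurableSpace α] {μ : Measure α} {p : ℝ≥0∞}
    {k : α → Matrix (Fin d) (Fin d) ℝ} (hk : ∀ i j, MemLp (fun x => k x i j) p μ) :
    MemLp (fun x => Matrix.toEuclideanCLM (𝕜 := ℝ) (k x)) p μ := by
  have e : (fun x => Matrix.toEuclideanCLM (𝕜 := ℝ) (k x)) = fun x => ∑ i, ∑ j,
      k x i j • Matrix.toEuclideanCLM (𝕜 := ℝ) (Matrix.single i j (1 : ℝ)) := by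
    funext x
    conv_lhs => rw [Matrix.matrix_eq_sum_single (k x)]
    simp only [map_sum]
    refine Finset.sum_congr rfl fun i _ => Finset.sum_congr rfl fun j _ => ?_
    rw [← map_smul, Matrix.smul_single, smul_eq_mul, mul_one]
  rw [e]
  exact memLp_sum_smul_vector hk fun i j =>
    Matrix.toEuclideanCLM (𝕜 := ℝ) (Matrix.single i j (1 : ℝ))

lemma toEuclideanCLM_apply_eq_inner (A : Matrix (Fin d) (Fin d) ℝ) (v : Eu d) (i : Fin d) :
    Matrix.toEuclideanCLM (𝕜 := ℝ) A v i = ⟪(WithLp.toLp 2 (A i) : Eu d), v⟫ := by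
  rw [Matrix.ofLp_toEuclideanCLM, PiLp.inner_apply]
  simp [Matrix.mulVec, dotProduct, mul_comm]

lemma integral_toEuclideanCLM_apply {α : Type*} [MeasurableSpace α] {μ : Measure α}
    {k : α → Matrix (Fin d) (Fin d) ℝ} {f : α → Eu d}
    (hk : ∀ i, MemLp (fun y => (WithLp.toLp 2 (k y i) : Eu d)) 2 μ) (hf : MemLp f 2 μ) :
    ∫ y, Matrix.toEuclideanCLM (𝕜 := ℝ) (k y) (f y) ∂μ
      = WithLp.toLp 2 fun i => ∫ y, ⟪(WithLp.toLp 2 (k y i) : Eu d), f y⟫ ∂μ := by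
  ext i
  rw [eval_integral_piLp fun i => by
    simp_rw [toEuclideanCLM_apply_eq_inner]
    exact integrable_inner_of_memLp (hk i) hf]
  simp_rw [toEuclideanCLM_apply_eq_inner]

lemma gradient_add_of_contDiff {ψ : Eu d → ℝ} (hφ : ContDiff ℝ ∞ φ) (hψ : ContDiff ℝ ∞ ψ) :
    gradient (φ + ψ) = gradient φ + gradient ψ := by
  funext x
  simp only [gradient, Pi.add_apply]
  rw [fderiv_add (hφ.differentiable (by simp)).differentiableAt
    (hψ.differentiable (by simp)).differentiableAt, map_add]

lemma gradient_const_smul_of_contDiff (hφ : ContDiff ℝ ∞ φ) (a : ℝ) :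
    gradient (a • φ) = a • gradient φ := by
  funext x
  simp only [gradient, Pi.smul_apply]
  rw [fderiv_const_smul (hφ.differentiable (by simp)).differentiableAt, map_smul]

/-- The gradients of test functions, as a subspace of `L²(μ; ℝ^d)`. -/
def testGradients (μ : P2 d) : Submodule ℝ (Lp (Eu d) 2 μ.meas) where
  carrier := {f | ∃ φ : Eu d → ℝ, ContDiff ℝ ∞ φ ∧ HasCompactSupport φ ∧ f =ᵐ[μ.meas] gradient φ}
  zero_mem' := by
    refine ⟨0, contDiff_const, HasCompactSupport.zero, ?_⟩
    filter_upwards [Lp.coeFn_zero (Eu d) 2 μ.meas] with x hx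
    rw [hx]
    simp [gradient]
  add_mem' := by
    rintro f g ⟨φ, hφ, hφc, hf⟩ ⟨ψ, hψ, hψc, hg⟩
    refine ⟨φ + ψ, hφ.add hψ, hφc.add hψc, ?_⟩
    rw [gradient_add_of_contDiff hφ hψ]
    exact (Lp.coeFn_add f g).trans (hf.add hg)
  smul_mem' := by
    rintro a f ⟨φ, hφ, hφc, hf⟩
    refine ⟨a • φ, hφ.const_smul a, hφc.smul_left (f := fun _ => a), ?_⟩
    rw [gradient_const_smul_of_contDiff hφ]
    exact (Lp.coeFn_smul a f).trans (hf.const_smul a)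

lemma integral_inner_gradient_eq_zero {μ : P2 d} {n : Lp (Eu d) 2 μ.meas}
    (hn : n ∈ (testGradients μ)ᗮ) {ψ : Eu d → ℝ} (hψ : ContDiff ℝ ∞ ψ)
    (hψc : HasCompactSupport ψ) : ∫ x, ⟪gradient ψ x, n x⟫ ∂μ.meas = 0 := by
  have hm := memLp_gradient hψ hψc (p := 2) μ.meas
  have := hn (hm.toLp _) ⟨ψ, hψ, hψc, hm.coeFn_toLp⟩
  rw [L2.inner_def] at this
  rw [← this]
  refine integral_congr_ae ?_
  filter_upwards [hm.coeFn_toLp] with x hx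
  rw [hx]

section Operator

variable {F : P2 d → ℝ} {G : P2 d → Eu d → Eu d}
  {K : P2 d → Eu d → Eu d → Matrix (Fin d) (Fin d) ℝ} {μ : P2 d}
  {H : Lp (Eu d) 2 μ.meas →L[ℝ] Lp (Eu d) 2 μ.meas}

lemma SufficientlySmooth.inTangent_row (hF : SufficientlySmooth F G K) (μ : P2 d) (x : Eu d)
    (i : Fin d) : InTangent μ fun y => (WithLp.toLp 2 (K μ x y i) : Eu d) := by
  obtain ⟨_, _, _, _, _, h⟩ := hF.hess μ
  exact (h x i).1

lemma SufficientlySmooth.operator_ae_eq (hF : SufficientlySmooth F G K)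
    (hH : IsIntegralOperator μ (K μ) H) {f : Lp (Eu d) 2 μ.meas} (hf : f =ᵐ[μ.meas] gradient φ) :
    H f =ᵐ[μ.meas] kernelField μ (K μ) φ := by
  filter_upwards [hH f] with x hx
  rw [hx, integral_toEuclideanCLM_apply (fun i => (hF.inTangent_row μ x i).1) (Lp.memLp f),
    kernelField]
  congr 1 with i
  refine integral_congr_ae ?_
  filter_upwards [hf] with y hy
  rw [hy]

/-- Each component of H n at x is the pairing of `n` with a row of the kernel, which is tangent. -/
lemma SufficientlySmooth.operator_eq_zero (hF : SufficientlySmooth F G K)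
    (hH : IsIntegralOperator μ (K μ) H) {n : Lp (Eu d) 2 μ.meas}
    (hn : n ∈ (testGradients μ)ᗮ) : H n = 0 := by
  apply Lp.ext
  filter_upwards [hH n, Lp.coeFn_zero (Eu d) 2 μ.meas] with x hx h0
  rw [hx, h0, integral_toEuclideanCLM_apply (fun i => (hF.inTangent_row μ x i).1) (Lp.memLp n)]
  ext i
  exact (hF.inTangent_row μ x i).integral_inner_eq_zero (Lp.memLp n)
    fun ψ hψ hψc => integral_inner_gradient_eq_zero hn hψ hψc

/-- Write v = t + n with t in the closure of the gradients and n orthogonal to it. Then H n = 0 and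
⟨n, H t⟩ = 0, so only ⟨t, H t⟩ remains, which is nonnegative by density. -/
lemma SufficientlySmooth.inner_operator_nonneg (hF : SufficientlySmooth F G K)
    (hac : μ.meas ≪ volume) (hmin : IsW2LocalMin F μ) (hH : IsIntegralOperator μ (K μ) H)
    (v : Lp (Eu d) 2 μ.meas) : 0 ≤ ⟪v, H v⟫ := by
  have hpos : ∀ t ∈ testGradients μ, 0 ≤ ⟪t, H t⟫ := by
    rintro t ⟨φ, hφ, hφc, ht⟩
    have hk := hF.operator_ae_eq hH ht
    have hkm : MemLp (kernelField μ (K μ) φ) 2 μ.meas := (memLp_congr_ae hk).1 (Lp.memLp _)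
    refine (hF.integral_inner_kernelField_nonneg hac hmin hφ hφc hkm).trans (le_of_eq ?_)
    rw [L2.inner_def]
    refine integral_congr_ae ?_
    filter_upwards [hk, ht] with x h1 h2
    rw [h1, h2, real_inner_comm]
  have horth : ∀ n ∈ (testGradients μ)ᗮ, ∀ t ∈ testGradients μ, ⟪n, H t⟫ = 0 := by
    rintro n hn t ⟨φ, hφ, hφc, ht⟩
    have hk := hF.operator_ae_eq hH ht
    have hkm : MemLp (kernelField μ (K μ) φ) 2 μ.meas := (memLp_congr_ae hk).1 (Lp.memLp _)
    rw [← hF.integral_inner_kernelField_eq_zero hac hmin hφ hφc hkm (Lp.memLp n)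
      fun ψ hψ hψc => integral_inner_gradient_eq_zero hn hψ hψc, L2.inner_def]
    refine integral_congr_ae ?_
    filter_upwards [hk] with x h1
    rw [h1, real_inner_comm]
  have hpos' : ∀ t ∈ (testGradients μ).topologicalClosure, 0 ≤ ⟪t, H t⟫ := fun t ht =>
    closure_minimal (t := {t | 0 ≤ ⟪t, H t⟫}) hpos
      (isClosed_le continuous_const (continuous_id.inner H.continuous)) ht
  have horth' : ∀ n ∈ (testGradients μ)ᗮ, ∀ t ∈ (testGradients μ).topologicalClosure,
      ⟪n, H t⟫ = 0 := fun n hn t ht =>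
    closure_minimal (t := {t | ⟪n, H t⟫ = 0}) (horth n hn)
      (isClosed_eq (continuous_const.inner H.continuous) continuous_const) ht
  have : CompleteSpace (testGradients μ).topologicalClosure :=
    (testGradients μ).isClosed_topologicalClosure.completeSpace_coe
  obtain ⟨t, ht, n, hn, rfl⟩ :=
    (testGradients μ).topologicalClosure.exists_add_mem_mem_orthogonal v
  rw [Submodule.orthogonal_closure] at hn
  rw [map_add, hF.operator_eq_zero hH hn, add_zero, inner_add_left, horth' n hn t ht, add_zero]
  exact hpos' t ht

end Operator

end HessianOperator

end WassersteinOpt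

end

theorem mainTheorem5 {d : ℕ} (F : WassersteinOpt.P2 d → ℝ)
    (G : WassersteinOpt.P2 d → WassersteinOpt.Eu d → WassersteinOpt.Eu d)
    (K : WassersteinOpt.P2 d → WassersteinOpt.Eu d → WassersteinOpt.Eu d →
      Matrix (Fin d) (Fin d) ℝ)
    (hF : WassersteinOpt.SufficientlySmooth F G K)
    (μ : WassersteinOpt.P2 d) (hac : μ.meas ≪ volume)
    (hmin : WassersteinOpt.IsW2LocalMin F μ) :
    ∃ H : Lp (WassersteinOpt.Eu d) 2 μ.meas →L[ℝ] Lp (WassersteinOpt.Eu d) 2 μ.meas,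
      WassersteinOpt.IsIntegralOperator μ (K μ) H ∧ ∀ v, 0 ≤ ⟪v, H v⟫ := by
  obtain ⟨H, hH⟩ := WassersteinOpt.exists_integralOperator
    (WassersteinOpt.memLp_toEuclideanCLM (hF.hess_memLp μ))
  exact ⟨H, hH, hF.inner_operator_nonneg hac hmin hH⟩
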